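/- Let $\mathbb D$ be the open unit disk and $\mathbb T$ the unit circle. For $\alpha>0$ let $\mathcal F_\alpha$ be the space of functions $g$ on $\mathbb D$ of the form $$g(z)=\int_{\mathbb T}\frac{d\mu(\xi)}{(1-\overline{\xi}z)^{\alpha}},\qquad z\in\mathbb D,\tag{1}$$ with $\mu$ a complex Borel measure on $\mathbb T$ (principal branch of the power), normed by $\|g\|_{\mathcal F_\alpha}=\inf\{\|\mu\| : (1)\text{ holds}\}$, where $\|\mu\|$ is the total variation. Let $m_\alpha$ be the set of holomorphic $f:\mathbb D\to\mathbb C$ such that $fg\in\mathcal F_\alpha$ for every $g\in\mathcal F_\alpha$, and put $\|f\|_{m_\alpha}=\sup\{\|fg\|_{\mathcal F_\alpha} : \|g\|_{\mathcal F_\alpha}\le 1\}$. Let $\|f\|_{H^\infty}=\sup_{z\in\mathbb D}|f(z)|$ and, for $0\le r<1$, let $$A(r,f)=\int_0^r\int_0^{2\pi}|f'(\rho e^{i\theta})|^2\,\rho\,d\theta\,d\rho .$$ There is a universal constant $c>0$ (independent of $\alpha$, $f$ and $r$) such that: (i) if $0<\alpha<1$ and $f\in m_\alpha$, then $\|f\|_{H^\infty}<\infty$,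 $\|f\|_{m_\alpha}<\infty$, and for all $0\le r<1$ $$A(r,f)\le c\,\|f\|_{H^\infty}\,\|f\|_{m_\alpha}\,\frac1{(1-r)^{\alpha}};$$ (ii) if $f\in m_1$, then $\|f\|_{H^\infty}<\infty$, $\|f\|_{m_1}<\infty$, and for all $0<r<1$ $$A(r,f)\le c\,\|f\|_{H^\infty}\,\|f\|_{m_1}\,\frac{1}{1-r}\,\frac{1}{\log\frac1{1-r}} .$$ -/

import Mathlib

open MeasureTheory Metric
open scoped ENNReal

noncomputable section

namespace FractionalCauchy

/-- The Borel `σ`-algebra on the unit circle `𝕋`. -/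
instance instMeasurableSpaceCircle : MeasurableSpace Circle := borel Circle

instance instBorelSpaceCircle : BorelSpace Circle := ⟨rfl⟩

/-- The fractional Cauchy transform of order `α` of a complex Borel measure `μ` on the circle,
`z ↦ ∫ (1 - conj ξ * z) ^ (-α) dμ(ξ)`, with the principal branch of the power
(for `|z| < 1` the base has positive real part). -/
def transform (α : ℝ) (μ : ComplexMeasure Circle) (z : ℂ) : ℂ :=
  μ.integral (fun ξ : Circle => 1 / (1 - (starRingEnd ℂ) (ξ : ℂ) * z) ^ (α : ℂ))
    (ContinuousLinearMap.mul ℝ ℂ)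

/-- `μ` represents `g` on the open unit disk. Only the values of `g` on the disk matter. -/
def Represents (α : ℝ) (μ : ComplexMeasure Circle) (g : ℂ → ℂ) : Prop :=
  ∀ z ∈ ball (0 : ℂ) 1, g z = transform α μ z

/-- The space `F_α` of fractional Cauchy transforms. -/
def space (α : ℝ) : Set (ℂ → ℂ) :=
  {g | ∃ μ : ComplexMeasure Circle, Represents α μ g}

/-- The norm of `F_α`: the infimum of the total variations of the representing measures
(it is `∞` off `F_α`). -/
def spaceNorm (α : ℝ) (g : ℂ → ℂ) : ℝ≥0∞ :=
  ⨅ (μ : ComplexMeasure Circle) (_ : Represents α μ g), μ.variation Set.univ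

/-- The set `m_α` of multipliers of `F_α`. -/
def multipliers (α : ℝ) : Set (ℂ → ℂ) :=
  {f | DifferentiableOn ℂ f (ball (0 : ℂ) 1) ∧
    ∀ g ∈ space α, (fun z => f z * g z) ∈ space α}

/-- The multiplier norm `sup {‖f g‖_{F_α} : ‖g‖_{F_α} ≤ 1}`. -/
def multiplierNorm (α : ℝ) (f : ℂ → ℂ) : ℝ≥0∞ :=
  ⨆ (g : ℂ → ℂ) (_ : g ∈ space α ∧ spaceNorm α g ≤ 1), spaceNorm α (fun z => f z * g z)

/-- The norm of `H^∞`: the supremum of `|f|` over the open unit disk. -/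
def hInftyNorm (f : ℂ → ℂ) : ℝ≥0∞ :=
  ⨆ (z : ℂ) (_ : z ∈ ball (0 : ℂ) 1), ‖f z‖ₑ

/-- The area function `A(r, f)`. -/
def area (r : ℝ) (f : ℂ → ℂ) : ℝ :=
  ∫ ρ in (0 : ℝ)..r, ∫ θ in (0 : ℝ)..(2 * Real.pi),
    ‖deriv f ((ρ : ℂ) * Complex.exp ((θ : ℂ) * Complex.I))‖ ^ 2 * ρ

end FractionalCauchy

end

namespace FractionalCauchy

/-! Multiplying the kernel at `ξ`, the transform of a unit point mass, by `f` gives the transform of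
a measure `ν` with `‖ν‖ < M`, for any `M` above the multiplier norm. That norm is finite by the open
mapping theorem on the closed relation "`f` times the transform of `μ` is the transform of `ν`".
Evaluating at `z` on the radius towards `ξ` gives `|f(z)| ≤ ‖ν‖`.

Dividing by the kernel and differentiating, `|f'(z)| |1 - ξ̄z|^(1-α) ≤ α ∫ |ζ - ξ| |1 - ζ̄z|^(-α-1)
d|ν|(ζ)`. Integrated over `|z| = r`, the right side is `O(M (1-r)^(-α))`, uniformly in `α`, and the
choices `ξ = ±1` remove the weight on the left (`integral_norm_deriv_le`). For `α = 1` there is no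
weight on the left, and `|ζ - ξ| ≤ |1 - ζ̄z| + |1 - ξ̄z|` leaves room for an extra factor `1/|1 -
ξ̄z|` at the same cost; integrating over `ξ` turns it into a gain of `log (1/(1-r))`
(`integral_norm_deriv_mul_log_le`).

Finally Green's formula (`two_mul_area`) bounds `2 A(r, f)` by `‖f‖_∞` times the integral of `|f'|`
over the angle. -/

/-! ### Complex measures as a Banach space -/

instance isFiniteMeasure_variation {X : Type*} [MeasurableSpace X] (μ : ComplexMeasure X) :
    IsFiniteMeasure μ.variation := by
  have hfin (s : SignedMeasure X) : IsFiniteMeasure s.variation := by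
    rw [← SignedMeasure.totalVariation_eq_variation]; infer_instance
  have := hfin (ComplexMeasure.re μ)
  have := hfin (ComplexMeasure.im μ)
  refine isFiniteMeasure_of_le
    ((ComplexMeasure.re μ).variation + (ComplexMeasure.im μ).variation) ?_
  refine VectorMeasure.variation_le_of_forall_enorm_le fun E _ => ?_
  rw [Measure.add_apply]
  refine le_trans ?_ (add_le_add (VectorMeasure.enorm_measure_le_variation _ E)
    (VectorMeasure.enorm_measure_le_variation _ E))
  simp only [ComplexMeasure.re_apply, ComplexMeasure.im_apply]
  rw [← ofReal_norm, ← ofReal_norm, ← ofReal_norm, ← ENNReal.ofReal_add (norm_nonneg _)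
    (norm_nonneg _)]
  exact ENNReal.ofReal_le_ofReal (Complex.norm_le_abs_re_add_abs_im _)

/-- The complex measures on `X`, normed by the total variation. -/
def TotalVariationSpace (X : Type*) [MeasurableSpace X] : Type _ := ComplexMeasure X

namespace TotalVariationSpace

variable {X : Type*} [MeasurableSpace X]

noncomputable instance : AddCommGroup (TotalVariationSpace X) :=
  inferInstanceAs (AddCommGroup (ComplexMeasure X))

noncomputable instance : Module ℝ (TotalVariationSpace X) :=
  inferInstanceAs (Module ℝ (ComplexMeasure X))

/-- The complex measure underlying an element of the total variation space. -/
def toMeasure (μ : TotalVariationSpace X) : ComplexMeasure X := μ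

/-- A complex measure as an element of the total variation space. -/
def ofMeasure (μ : ComplexMeasure X) : TotalVariationSpace X := μ

@[simp] lemma toMeasure_add (μ ν : TotalVariationSpace X) :
    (μ + ν).toMeasure = μ.toMeasure + ν.toMeasure := rfl
@[simp] lemma toMeasure_smul (c : ℝ) (μ : TotalVariationSpace X) :
    (c • μ).toMeasure = c • μ.toMeasure := rfl

noncomputable instance : Norm (TotalVariationSpace X) :=
  ⟨fun μ => (μ.toMeasure.variation Set.univ).toReal⟩

lemma norm_def (μ : TotalVariationSpace X) :
    ‖μ‖ = (μ.toMeasure.variation Set.univ).toReal := rfl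

lemma core : NormedSpace.Core ℝ (TotalVariationSpace X) where
  norm_nonneg _ := ENNReal.toReal_nonneg
  norm_smul c μ := by
    rw [norm_def, norm_def, toMeasure_smul, VectorMeasure.variation_smul, Measure.smul_apply,
      ENNReal.smul_def, smul_eq_mul, ENNReal.toReal_mul, ENNReal.coe_toReal, coe_nnnorm]
  norm_triangle μ ν := by
    simp only [norm_def, toMeasure_add]
    rw [← ENNReal.toReal_add (measure_ne_top _ _) (measure_ne_top _ _)]
    exact ENNReal.toReal_mono (by finiteness) (VectorMeasure.variation_add_le Set.univ)
  norm_eq_zero_iff μ := by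
    rw [norm_def, ENNReal.toReal_eq_zero_iff, or_iff_left (measure_ne_top _ _),
      Measure.measure_univ_eq_zero, VectorMeasure.variation_eq_zero]
    rfl

noncomputable instance : NormedAddCommGroup (TotalVariationSpace X) :=
  NormedAddCommGroup.ofCore core

noncomputable instance : NormedSpace ℝ (TotalVariationSpace X) := NormedSpace.ofCore core

lemma enorm_def (μ : TotalVariationSpace X) : ‖μ‖ₑ = μ.toMeasure.variation Set.univ := by
  rw [← ofReal_norm, norm_def, ENNReal.ofReal_toReal (measure_ne_top _ _)]

lemma norm_apply_le (μ : TotalVariationSpace X) (s : Set X) : ‖μ.toMeasure s‖ ≤ ‖μ‖ := by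
  rw [← ENNReal.ofReal_le_ofReal_iff (norm_nonneg _), ofReal_norm, ofReal_norm, enorm_def]
  exact (VectorMeasure.enorm_measure_le_variation _ _).trans (measure_mono (Set.subset_univ _))

lemma summable_apply {u : ℕ → TotalVariationSpace X} (hu : Summable fun n => ‖u n‖) (s : Set X) :
    Summable fun n => ‖(u n).toMeasure s‖ :=
  Summable.of_nonneg_of_le (fun _ => norm_nonneg _) (fun n => norm_apply_le (u n) s) hu

/-- Needed to exchange sums in the proof of countable additivity: for fixed `n` the sum over `i` is
at most the variation of `u n`. -/
lemma summable_prod_apply {u : ℕ → TotalVariationSpace X} (hu : Summable fun n => ‖u n‖)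
    {A : ℕ → Set X} (hA : ∀ i, MeasurableSet (A i)) (hd : Pairwise (Function.onFun Disjoint A)) :
    Summable fun p : ℕ × ℕ => (u p.1).toMeasure (A p.2) := by
  have hfin : ∑' p : ℕ × ℕ, ‖(u p.1).toMeasure (A p.2)‖ₑ ≠ ∞ := by
    rw [ENNReal.tsum_prod (f := fun n i => ‖(u n).toMeasure (A i)‖ₑ)]
    refine ne_top_of_le_ne_top (ENNReal.tsum_coe_ne_top_iff_summable.2 ?_)
      (ENNReal.tsum_le_tsum (g := fun n => ‖u n‖ₑ) fun n => ?_)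
    · exact NNReal.summable_coe.1 hu
    · calc ∑' i, ‖(u n).toMeasure (A i)‖ₑ
          ≤ ∑' i, (u n).toMeasure.variation (A i) :=
            ENNReal.tsum_le_tsum fun i => VectorMeasure.enorm_measure_le_variation _ _
        _ = (u n).toMeasure.variation (⋃ i, A i) := (measure_iUnion hd hA).symm
        _ ≤ ‖u n‖ₑ := by rw [enorm_def]; exact measure_mono (Set.subset_univ _)
  exact Summable.of_norm (NNReal.summable_coe.2 (ENNReal.tsum_coe_ne_top_iff_summable.1 hfin))

/-- The sum of an absolutely summable series of complex measures. -/
noncomputable def tsumMeasure (u : ℕ → TotalVariationSpace X) (hu : Summable fun n => ‖u n‖) :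
    ComplexMeasure X where
  measureOf' s := ∑' n, (u n).toMeasure s
  empty' := by simp
  not_measurable' s hs := by simp [VectorMeasure.not_measurable _ hs]
  m_iUnion' A hA hd := by
    have h := summable_prod_apply hu hA hd
    have h2 : ∀ n, HasSum (fun i => (u n).toMeasure (A i)) ((u n).toMeasure (⋃ i, A i)) :=
      fun n => (u n).toMeasure.m_iUnion hA hd
    have h3 := h.hasSum.prod_fiberwise h2
    have h4 := (Equiv.prodComm ℕ ℕ).hasSum_iff.2 h.hasSum
    have h5 := h4.prod_fiberwise
      (fun i => ((summable_apply hu (A i)).of_norm).hasSum)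
    rw [h3.tsum_eq]
    exact h5

instance : CompleteSpace (TotalVariationSpace X) := by
  refine NormedAddCommGroup.completeSpace_of_summable_imp_tendsto fun u hu => ?_
  refine ⟨ofMeasure (tsumMeasure u hu), ?_⟩
  rw [tendsto_iff_norm_sub_tendsto_zero]
  have htail := tendsto_sum_nat_add fun n => ‖u n‖
  refine squeeze_zero (fun _ => norm_nonneg _) (fun N => ?_) htail
  have hN : Summable fun n => ‖u (n + N)‖ := (summable_nat_add_iff N).2 hu
  have hsum (s : Finset ℕ) : (∑ i ∈ s, u i).toMeasure = ∑ i ∈ s, (u i).toMeasure := rfl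
  have hle : ‖(∑ i ∈ Finset.range N, u i) - ofMeasure (tsumMeasure u hu)‖ₑ
      ≤ ∑' n, ‖u (n + N)‖ₑ := by
    rw [enorm_sub_rev, enorm_def]
    have : ∑' n, ‖u (n + N)‖ₑ
        = (Measure.sum fun n => (u (n + N)).toMeasure.variation) Set.univ := by
      rw [Measure.sum_apply _ MeasurableSet.univ]
      exact tsum_congr fun n => enorm_def _
    rw [this]
    -- Variation is the least measure dominating setwise, so a setwise bound by the sum of the tail
    -- variations suffices.
    refine VectorMeasure.variation_le_of_forall_enorm_le (fun E hE => ?_) _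
    have e : (ofMeasure (tsumMeasure u hu) - ∑ i ∈ Finset.range N, u i).toMeasure E
        = ∑' n, (u (n + N)).toMeasure E := by
      have h1 : (ofMeasure (tsumMeasure u hu) - ∑ i ∈ Finset.range N, u i).toMeasure E
        = (∑' n, (u n).toMeasure E) - ∑ i ∈ Finset.range N, (u i).toMeasure E := by
        change (tsumMeasure u hu - (∑ i ∈ Finset.range N, u i).toMeasure) E = _
        rw [hsum, sub_apply, FunLike.coe_sum, Finset.sum_apply]
        rfl
      rw [h1, ← (summable_apply hu E).of_norm.sum_add_tsum_nat_add N]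
      ring
    rw [e, Measure.sum_apply _ hE]
    refine enorm_tsum_le_tsum_enorm.trans
      (ENNReal.tsum_le_tsum fun n => VectorMeasure.enorm_measure_le_variation _ E)
  have h2 : ∑' n, ‖u (n + N)‖ₑ = ENNReal.ofReal (∑' n, ‖u (n + N)‖) := by
    rw [ENNReal.ofReal_tsum_of_nonneg (fun _ => norm_nonneg _) hN]
    exact tsum_congr fun n => (ofReal_norm _).symm
  rw [h2, ← ofReal_norm] at hle
  exact (ENNReal.ofReal_le_ofReal_iff (tsum_nonneg fun _ => norm_nonneg _)).1 hle

end TotalVariationSpace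

/-! ### The kernel and pointwise bounds for transforms -/

/-- The base `1 - conj ξ * z` of the kernel. -/
noncomputable def base (ξ : Circle) (z : ℂ) : ℂ := 1 - (starRingEnd ℂ) (ξ : ℂ) * z

lemma norm_conj_coe (ξ : Circle) : ‖(starRingEnd ℂ) (ξ : ℂ)‖ = 1 := by
  rw [RCLike.norm_conj, Circle.norm_coe]

lemma one_sub_norm_le_norm_base (ξ : Circle) (z : ℂ) : 1 - ‖z‖ ≤ ‖base ξ z‖ := by
  have := norm_sub_norm_le (1 : ℂ) ((starRingEnd ℂ) (ξ : ℂ) * z)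
  rwa [norm_mul, norm_conj_coe, one_mul, norm_one] at this

lemma base_mem_slitPlane (ξ : Circle) {z : ℂ} (hz : ‖z‖ < 1) : base ξ z ∈ Complex.slitPlane := by
  left
  have h : ((starRingEnd ℂ) (ξ : ℂ) * z).re ≤ ‖z‖ :=
    (Complex.re_le_norm _).trans_eq (by rw [norm_mul, norm_conj_coe, one_mul])
  rw [base, Complex.sub_re, Complex.one_re]
  linarith

lemma norm_base_pos (ξ : Circle) {z : ℂ} (hz : ‖z‖ < 1) : 0 < ‖base ξ z‖ :=
  (sub_pos.2 hz).trans_le (one_sub_norm_le_norm_base ξ z)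

lemma base_ne_zero (ξ : Circle) {z : ℂ} (hz : ‖z‖ < 1) : base ξ z ≠ 0 :=
  norm_pos_iff.1 (norm_base_pos ξ hz)

lemma continuous_base : Continuous fun p : Circle × ℂ => base p.1 p.2 := by
  unfold base
  fun_prop

lemma hasDerivAt_base (ξ : Circle) (z : ℂ) :
    HasDerivAt (base ξ) (-(starRingEnd ℂ) (ξ : ℂ)) z := by
  have h := ((hasDerivAt_id z).const_mul ((starRingEnd ℂ) (ξ : ℂ))).const_sub 1
  rw [mul_one] at h
  exact h

lemma continuous_base_cpow (s : ℂ) {z : ℂ} (hz : ‖z‖ < 1) :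
    Continuous fun ξ : Circle => base ξ z ^ s := by
  have h : Continuous fun ξ : Circle => base ξ z :=
    continuous_base.comp (Continuous.prodMk_left z)
  exact h.cpow continuous_const fun ξ => base_mem_slitPlane ξ hz

lemma continuous_kernel (α : ℝ) {z : ℂ} (hz : ‖z‖ < 1) :
    Continuous fun ξ : Circle => 1 / base ξ z ^ (α : ℂ) := by
  refine continuous_const.div (continuous_base_cpow _ hz) fun ξ => ?_
  rw [Ne, Complex.cpow_eq_zero_iff, not_and_or]
  exact Or.inl (base_ne_zero ξ hz)

lemma norm_kernel (α : ℝ) (ξ : Circle) (z : ℂ) :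
    ‖1 / base ξ z ^ (α : ℂ)‖ = ‖base ξ z‖ ^ (-α) := by
  rw [norm_div, norm_one, Complex.norm_cpow_real, Real.rpow_neg (norm_nonneg _), one_div]

lemma norm_kernel_le {α : ℝ} (hα : 0 ≤ α) (ξ : Circle) {z : ℂ} (hz : ‖z‖ < 1) :
    ‖1 / base ξ z ^ (α : ℂ)‖ ≤ (1 - ‖z‖) ^ (-α) := by
  rw [norm_kernel]
  exact Real.rpow_le_rpow_of_nonpos (sub_pos.2 hz) (one_sub_norm_le_norm_base ξ z) (by linarith)

lemma integrable_of_continuous (μ : ComplexMeasure Circle) {E : Type*} [NormedAddCommGroup E]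
    [SecondCountableTopology E]
    {g : Circle → E} (hg : Continuous g) : Integrable g μ.variation :=
  hg.integrable_of_hasCompactSupport (HasCompactSupport.of_compactSpace g)

lemma integrable_kernel (α : ℝ) {z : ℂ} (hz : ‖z‖ < 1) (μ : ComplexMeasure Circle) :
    μ.Integrable fun ξ : Circle => 1 / base ξ z ^ (α : ℂ) :=
  integrable_of_continuous μ (continuous_kernel α hz)

lemma transform_eq (α : ℝ) (μ : ComplexMeasure Circle) (z : ℂ) :
    transform α μ z = μ.integral (fun ξ => 1 / base ξ z ^ (α : ℂ))
      (ContinuousLinearMap.mul ℝ ℂ) := rfl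

lemma norm_transform_le {α : ℝ} (hα : 0 ≤ α) (μ : ComplexMeasure Circle) {z : ℂ} (hz : ‖z‖ < 1) :
    ‖transform α μ z‖ ≤ (1 - ‖z‖) ^ (-α) * (μ.variation Set.univ).toReal := by
  have h := VectorMeasure.norm_integral_le_of_norm_le_const (μ := μ)
    (B := ContinuousLinearMap.mul ℝ ℂ)
    (Filter.Eventually.of_forall fun ξ => norm_kernel_le hα ξ hz)
  rwa [ContinuousLinearMap.opNorm_mul, mul_one] at h

/-- Evaluation of the transform at a point of the disk, as a continuous functional of the
measure. -/
noncomputable def transformCLM {α : ℝ} (hα : 0 ≤ α) {z : ℂ} (hz : ‖z‖ < 1) :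
    TotalVariationSpace Circle →L[ℝ] ℂ :=
  LinearMap.mkContinuous
    { toFun := fun μ => transform α μ.toMeasure z
      map_add' := fun μ ν => VectorMeasure.integral_add_vectorMeasure
        (integrable_kernel α hz μ.toMeasure) (integrable_kernel α hz ν.toMeasure)
      map_smul' := fun c _ => VectorMeasure.integral_smul_vectorMeasure _ c }
    ((1 - ‖z‖) ^ (-α)) fun μ => norm_transform_le hα μ.toMeasure hz

@[simp] lemma transformCLM_apply {α : ℝ} (hα : 0 ≤ α) {z : ℂ} (hz : ‖z‖ < 1)
    (μ : TotalVariationSpace Circle) : transformCLM hα hz μ = transform α μ.toMeasure z := rfl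

/-! ### Boundedness of multiplication and of `f` -/

/-- The pairs `(μ, ν)` of measures such that `f` times the transform of `μ` is the transform
of `ν`. -/
noncomputable def multiplierGraph {α : ℝ} (hα : 0 ≤ α) (f : ℂ → ℂ) :
    Submodule ℝ (TotalVariationSpace Circle × TotalVariationSpace Circle) :=
  ⨅ z : ball (0 : ℂ) 1, LinearMap.ker
    ((f z • (transformCLM hα (mem_ball_zero_iff.1 z.2)).comp (ContinuousLinearMap.fst ℝ _ _) -
      (transformCLM hα (mem_ball_zero_iff.1 z.2)).comp (ContinuousLinearMap.snd ℝ _ _) :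
        TotalVariationSpace Circle × TotalVariationSpace Circle →L[ℝ] ℂ) :
        TotalVariationSpace Circle × TotalVariationSpace Circle →ₗ[ℝ] ℂ)

lemma mem_multiplierGraph {α : ℝ} (hα : 0 ≤ α) (f : ℂ → ℂ)
    (p : TotalVariationSpace Circle × TotalVariationSpace Circle) :
    p ∈ multiplierGraph hα f ↔
      Represents α p.2.toMeasure fun z => f z * transform α p.1.toMeasure z := by
  simp [multiplierGraph, Represents, sub_eq_zero]

lemma isClosed_multiplierGraph {α : ℝ} (hα : 0 ≤ α) (f : ℂ → ℂ) :
    IsClosed (multiplierGraph hα f : Set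
      (TotalVariationSpace Circle × TotalVariationSpace Circle)) := by
  rw [multiplierGraph, Submodule.coe_iInf]
  exact isClosed_iInter fun z => ContinuousLinearMap.isClosed_ker _

/-- Representing measures are not unique, so the graph is only a closed relation. The multiplier
property makes its first projection surjective, and the open mapping theorem then selects `ν` with
norm control. -/
theorem exists_multiplier_bound {α : ℝ} (hα : 0 ≤ α) {f : ℂ → ℂ} (hf : f ∈ multipliers α) :
    ∃ C : ℝ, 0 < C ∧ ∀ μ : ComplexMeasure Circle, ∃ ν : ComplexMeasure Circle,
      Represents α ν (fun z => f z * transform α μ z) ∧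
        ν.variation Set.univ ≤ ENNReal.ofReal C * μ.variation Set.univ := by
  have : CompleteSpace (multiplierGraph hα f) :=
    (isClosed_multiplierGraph hα f).completeSpace_coe
  let T : multiplierGraph hα f →L[ℝ] TotalVariationSpace Circle :=
    (ContinuousLinearMap.fst ℝ _ _).comp (multiplierGraph hα f).subtypeL
  have hT : Function.Surjective T := by
    intro μ
    obtain ⟨ν, hν⟩ := hf.2 (transform α μ.toMeasure) ⟨μ.toMeasure, fun _ _ => rfl⟩
    exact ⟨⟨(μ, TotalVariationSpace.ofMeasure ν), (mem_multiplierGraph hα f _).2 hν⟩, rfl⟩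
  obtain ⟨C, hC, h⟩ := T.exists_preimage_norm_le hT
  refine ⟨C, hC, fun μ => ?_⟩
  obtain ⟨⟨⟨μ', ν⟩, hp⟩, rfl, hle⟩ := h (TotalVariationSpace.ofMeasure μ)
  refine ⟨ν.toMeasure, (mem_multiplierGraph hα f _).1 hp, ?_⟩
  -- The product carries the max norm.
  have h1 : ‖ν‖ ≤ C * ‖μ'‖ := (le_max_right _ _).trans hle
  have h2 := ENNReal.ofReal_le_ofReal h1
  rwa [ENNReal.ofReal_mul hC.le, ofReal_norm, ofReal_norm, TotalVariationSpace.enorm_def,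
    TotalVariationSpace.enorm_def] at h2

theorem multiplierNorm_lt_top {α : ℝ} (hα : 0 ≤ α) {f : ℂ → ℂ} (hf : f ∈ multipliers α) :
    multiplierNorm α f < ∞ := by
  obtain ⟨C, hC, h⟩ := exists_multiplier_bound hα hf
  refine lt_of_le_of_lt (b := ENNReal.ofReal C) (iSup₂_le fun g hg => ?_) ENNReal.ofReal_lt_top
  calc spaceNorm α (fun z => f z * g z) ≤ ENNReal.ofReal C * spaceNorm α g := by
        have hC0 : ENNReal.ofReal C ≠ 0 := by simpa using hC
        rw [mul_comm, ← ENNReal.div_le_iff hC0 ENNReal.ofReal_ne_top]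
        refine le_iInf₂ fun μ hμ => ?_
        rw [ENNReal.div_le_iff hC0 ENNReal.ofReal_ne_top, mul_comm]
        obtain ⟨ν, hν, hle⟩ := h μ
        refine (iInf₂_le ν fun z hz => ?_).trans hle
        rw [← hν z hz]
        exact congrArg (f z * ·) (hμ z hz)
    _ ≤ ENNReal.ofReal C := mul_le_of_le_one_right' hg.2

/-- The kernel at `ξ` is the transform of the unit Dirac mass there, hence lies in the unit ball.
The strict bound on `M` yields an actual measure without the infimum being attained. -/
theorem exists_represents_mul_kernel {α : ℝ} {f : ℂ → ℂ} {M : ℝ≥0∞}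
    (hM : multiplierNorm α f < M) (ξ : Circle) :
    ∃ ν : ComplexMeasure Circle, Represents α ν (fun z => f z * (1 / base ξ z ^ (α : ℂ))) ∧
      ν.variation Set.univ < M := by
  have hrep : Represents α (VectorMeasure.dirac ξ 1) fun z => 1 / base ξ z ^ (α : ℂ) := by
    intro z hz
    rw [transform_eq, VectorMeasure.integral_dirac'
      (continuous_kernel α (mem_ball_zero_iff.1 hz)).stronglyMeasurable]
    simp
  have hle : spaceNorm α (fun z => 1 / base ξ z ^ (α : ℂ)) ≤ 1 := by
    calc spaceNorm α (fun z => 1 / base ξ z ^ (α : ℂ))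
        ≤ (VectorMeasure.dirac ξ (1 : ℂ)).variation Set.univ :=
          iInf₂_le (VectorMeasure.dirac ξ (1 : ℂ)) hrep
      _ ≤ 1 := by simp
  have hlt : spaceNorm α (fun z => f z * (1 / base ξ z ^ (α : ℂ))) < M :=
    lt_of_le_of_lt (le_iSup₂ (f := fun (g : ℂ → ℂ) (_ : g ∈ space α ∧ spaceNorm α g ≤ 1) =>
      spaceNorm α fun z => f z * g z) _ ⟨⟨_, hrep⟩, hle⟩) hM
  simpa only [spaceNorm, iInf_lt_iff, exists_prop] using hlt

lemma exists_base_eq (z : ℂ) : ∃ ξ : Circle, base ξ z = ((1 - ‖z‖ : ℝ) : ℂ) := by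
  by_cases hz : z = 0
  · exact ⟨1, by simp [base, hz]⟩
  · have hz' : (‖z‖ : ℂ) ≠ 0 := by simpa using hz
    -- The radial projection of `z`, where the lower bound `1 - ‖z‖` for the base is attained.
    refine ⟨⟨z / ‖z‖, by simp [Submonoid.unitSphere, hz]⟩, ?_⟩
    have : (starRingEnd ℂ) z * z = (‖z‖ : ℂ) * ‖z‖ := by
      rw [Complex.conj_mul', sq]
    simp only [base, map_div₀, Complex.conj_ofReal]
    rw [div_mul_eq_mul_div, this, mul_div_cancel_right₀ _ hz']
    push_cast; ring

/-- For `ξ` radial to `z` the kernel has modulus `(1 - ‖z‖) ^ (-α)`, exactly the factor in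
`norm_transform_le`; it cancels. -/
theorem hInftyNorm_lt_top {α : ℝ} (hα : 0 ≤ α) {f : ℂ → ℂ} (hf : f ∈ multipliers α) :
    hInftyNorm f < ∞ := by
  obtain ⟨M, hM, hM'⟩ := exists_between (multiplierNorm_lt_top hα hf)
  refine lt_of_le_of_lt (iSup₂_le fun z hz => ?_) hM'
  have hz' := mem_ball_zero_iff.1 hz
  obtain ⟨ξ, hξ⟩ := exists_base_eq z
  obtain ⟨ν, hν, hlt⟩ := exists_represents_mul_kernel hM ξ
  have h := norm_transform_le hα ν hz'
  rw [← hν z hz, norm_mul, norm_kernel, hξ, Complex.norm_real, Real.norm_of_nonneg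
    (by linarith), mul_comm] at h
  have h' := le_of_mul_le_mul_left h (Real.rpow_pos_of_pos (by linarith) _)
  rw [← ofReal_norm]
  exact (ENNReal.ofReal_le_of_le_toReal h').trans hlt.le

lemma norm_le_hInftyNorm {f : ℂ → ℂ} (hf : hInftyNorm f < ∞) {z : ℂ} (hz : ‖z‖ < 1) :
    ‖f z‖ ≤ (hInftyNorm f).toReal := by
  rw [← ENNReal.ofReal_le_iff_le_toReal hf.ne, ofReal_norm]
  exact le_iSup₂ (f := fun z (_ : z ∈ ball (0 : ℂ) 1) => ‖f z‖ₑ) z (mem_ball_zero_iff.2 hz)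

/-! ### The derivative of `f` as an integral against `ν` -/

lemma integral_const_mul (μ : ComplexMeasure Circle) (c : ℂ) (g : Circle → ℂ) :
    μ.integral (fun ξ => c * g ξ) (ContinuousLinearMap.mul ℝ ℂ) =
      c * μ.integral g (ContinuousLinearMap.mul ℝ ℂ) := by
  rw [VectorMeasure.integral_eq_setToFun, VectorMeasure.integral_eq_setToFun]
  refine setToFun_smul _ (fun c s x => ?_) c g
  rw [transpose_eq_cbmApplyMeasure]
  simp [mul_assoc]

/-- The quotient of the `α`-th powers of two bases. -/
noncomputable def ratio (α : ℝ) (ξ ζ : Circle) (w : ℂ) : ℂ :=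
  base ξ w ^ (α : ℂ) * base ζ w ^ (-α : ℂ)

/-- The complex derivative of `ratio`. -/
noncomputable def ratioDeriv (α : ℝ) (ξ ζ : Circle) (w : ℂ) : ℂ :=
  α * ((starRingEnd ℂ) (ζ : ℂ) - (starRingEnd ℂ) (ξ : ℂ)) *
    (base ξ w ^ ((α : ℂ) - 1) * base ζ w ^ (-α - 1 : ℂ))

lemma hasDerivAt_ratio (α : ℝ) (ξ ζ : Circle) {w : ℂ} (hw : ‖w‖ < 1) :
    HasDerivAt (ratio α ξ ζ) (ratioDeriv α ξ ζ w) w := by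
  have h1 := (hasDerivAt_base ξ w).cpow_const (c := (α : ℂ)) (base_mem_slitPlane ξ hw)
  have h2 := (hasDerivAt_base ζ w).cpow_const (c := (-α : ℂ)) (base_mem_slitPlane ζ hw)
  refine (h1.mul h2).congr_deriv ?_
  have e1 : base ξ w ^ (α : ℂ) = base ξ w ^ ((α : ℂ) - 1) * base ξ w := by
    rw [Complex.cpow_sub _ _ (base_ne_zero ξ hw), Complex.cpow_one,
      div_mul_cancel₀ _ (base_ne_zero ξ hw)]
  have e2 : base ζ w ^ (-α : ℂ) = base ζ w ^ (-α - 1 : ℂ) * base ζ w := by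
    rw [Complex.cpow_sub _ _ (base_ne_zero ζ hw), Complex.cpow_one,
      div_mul_cancel₀ _ (base_ne_zero ζ hw)]
  -- The terms in `w` cancel: `ζ̄ (1 - ξ̄w) - ξ̄ (1 - ζ̄w) = ζ̄ - ξ̄`.
  rw [e1, e2, ratioDeriv]
  generalize base ξ w ^ ((α : ℂ) - 1) = p
  generalize base ζ w ^ (-α - 1 : ℂ) = q
  simp only [base]
  ring

lemma norm_ratioDeriv {α : ℝ} (hα : 0 ≤ α) (ξ ζ : Circle) (w : ℂ) :
    ‖ratioDeriv α ξ ζ w‖ =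
      α * ‖(ζ : ℂ) - ξ‖ * (‖base ξ w‖ ^ (α - 1) * ‖base ζ w‖ ^ (-α - 1)) := by
  have h1 : ((α : ℂ) - 1) = ((α - 1 : ℝ) : ℂ) := by push_cast; rfl
  have h2 : (-α - 1 : ℂ) = ((-α - 1 : ℝ) : ℂ) := by push_cast; rfl
  rw [ratioDeriv, norm_mul, norm_mul, norm_mul, h1, h2, Complex.norm_cpow_real,
    Complex.norm_cpow_real, Complex.norm_real, Real.norm_of_nonneg hα, ← map_sub,
    RCLike.norm_conj]

lemma norm_coe_sub_coe_le_two (ζ ξ : Circle) : ‖(ζ : ℂ) - ξ‖ ≤ 2 := by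
  refine (norm_sub_le _ _).trans ?_
  rw [Circle.norm_coe, Circle.norm_coe]; norm_num

lemma norm_ratioDeriv_le {α : ℝ} (hα : 0 ≤ α) (hα1 : α ≤ 1) (ξ ζ : Circle) {R : ℝ} (hR : R < 1)
    {w : ℂ} (hw : ‖w‖ ≤ R) :
    ‖ratioDeriv α ξ ζ w‖ ≤ α * 2 * ((1 - R) ^ (α - 1) * (1 - R) ^ (-α - 1)) := by
  have hR' : 0 < 1 - R := by linarith
  have hb (η : Circle) : 1 - R ≤ ‖base η w‖ :=
    le_trans (by linarith) (one_sub_norm_le_norm_base η w)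
  rw [norm_ratioDeriv hα]
  have h1 := Real.rpow_le_rpow_of_nonpos hR' (hb ξ) (by linarith : α - 1 ≤ 0)
  have h2 := Real.rpow_le_rpow_of_nonpos hR' (hb ζ) (by linarith : -α - 1 ≤ 0)
  have h3 := norm_coe_sub_coe_le_two ζ ξ
  gcongr

lemma continuous_ratio (α : ℝ) (ξ : Circle) {w : ℂ} (hw : ‖w‖ < 1) :
    Continuous fun ζ => ratio α ξ ζ w :=
  continuous_const.mul (continuous_base_cpow _ hw)

lemma eq_integral_ratio {α : ℝ} {f : ℂ → ℂ} {ν : ComplexMeasure Circle} {ξ : Circle}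
    (h : Represents α ν fun z => f z * (1 / base ξ z ^ (α : ℂ))) {w : ℂ} (hw : ‖w‖ < 1) :
    f w = ν.integral (fun ζ => ratio α ξ ζ w) (ContinuousLinearMap.mul ℝ ℂ) := by
  have hne : base ξ w ^ (α : ℂ) ≠ 0 := by
    rw [Ne, Complex.cpow_eq_zero_iff, not_and_or]
    exact Or.inl (base_ne_zero ξ hw)
  have h1 := h w (mem_ball_zero_iff.2 hw)
  simp only [ratio, integral_const_mul]
  simp only [transform_eq, one_div, ← Complex.cpow_neg] at h1
  rw [← h1, Complex.cpow_neg, mul_comm (f w), mul_inv_cancel_left₀ hne]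

/-- Dominated convergence for slopes: on a ball of radius `R` with `‖z‖ < R < 1` the mean value
inequality bounds them uniformly in `ζ`. -/
theorem hasDerivAt_integral_ratio {α : ℝ} (hα : 0 ≤ α) (hα1 : α ≤ 1) {f : ℂ → ℂ}
    {ν : ComplexMeasure Circle} {ξ : Circle}
    (h : Represents α ν fun z => f z * (1 / base ξ z ^ (α : ℂ))) {z : ℂ} (hz : ‖z‖ < 1) :
    HasDerivAt f
      (ν.integral (fun ζ => ratioDeriv α ξ ζ z) (ContinuousLinearMap.mul ℝ ℂ)) z := by
  rw [hasDerivAt_iff_tendsto_slope]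
  obtain ⟨R, hzR, hR⟩ := exists_between hz
  have hmem : ∀ᶠ w in nhdsWithin z {z}ᶜ, w ∈ ball (0 : ℂ) R :=
    mem_nhdsWithin_of_mem_nhds (isOpen_ball.mem_nhds (mem_ball_zero_iff.2 hzR))
  have hslope : ∀ᶠ w in nhdsWithin z {z}ᶜ,
      ν.integral (fun ζ => slope (ratio α ξ ζ) z w) (ContinuousLinearMap.mul ℝ ℂ)
        = slope f z w := by
    filter_upwards [hmem] with w hw
    have hw1 : ‖w‖ < 1 := (mem_ball_zero_iff.1 hw).trans hR
    simp only [slope, vsub_eq_sub, smul_eq_mul]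
    rw [integral_const_mul, VectorMeasure.integral_fun_sub
      (integrable_of_continuous ν (continuous_ratio α ξ hw1))
      (integrable_of_continuous ν (continuous_ratio α ξ hz)),
      ← eq_integral_ratio h hw1, ← eq_integral_ratio h hz]
  refine Filter.Tendsto.congr' hslope ?_
  refine VectorMeasure.tendsto_integral_filter_of_norm_le_const ?_
    ⟨α * 2 * ((1 - R) ^ (α - 1) * (1 - R) ^ (-α - 1)), ?_⟩ ?_
  · filter_upwards [hmem] with w hw
    have hw1 : ‖w‖ < 1 := (mem_ball_zero_iff.1 hw).trans hR
    have : Continuous fun ζ => slope (ratio α ξ ζ) z w := by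
      simp only [slope, vsub_eq_sub, smul_eq_mul]
      exact continuous_const.mul ((continuous_ratio α ξ hw1).sub (continuous_ratio α ξ hz))
    exact this.aestronglyMeasurable
  · filter_upwards [hmem, self_mem_nhdsWithin] with w hw hne
    refine Filter.Eventually.of_forall fun ζ => ?_
    have hlip := (convex_ball (0 : ℂ) R).norm_image_sub_le_of_norm_hasDerivWithin_le
      (f := ratio α ξ ζ) (f' := ratioDeriv α ξ ζ)
      (fun x hx => (hasDerivAt_ratio α ξ ζ
        ((mem_ball_zero_iff.1 hx).trans hR)).hasDerivWithinAt)
      (fun x hx => norm_ratioDeriv_le hα hα1 ξ ζ hR (mem_ball_zero_iff.1 hx).le)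
      (mem_ball_zero_iff.2 hzR) hw
    have hpos : 0 < ‖w - z‖ := norm_pos_iff.2 (sub_ne_zero.2 hne)
    rw [slope, vsub_eq_sub, norm_smul, norm_inv, inv_mul_le_iff₀ hpos, mul_comm]
    exact hlip
  · exact Filter.Eventually.of_forall fun ζ =>
      hasDerivAt_iff_tendsto_slope.1 (hasDerivAt_ratio α ξ ζ hz)

theorem norm_deriv_mul_le {α : ℝ} (hα : 0 ≤ α) (hα1 : α ≤ 1) {f : ℂ → ℂ}
    {ν : ComplexMeasure Circle} {ξ : Circle}
    (h : Represents α ν fun z => f z * (1 / base ξ z ^ (α : ℂ))) {z : ℂ} (hz : ‖z‖ < 1) :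
    ‖deriv f z‖ * ‖base ξ z‖ ^ (1 - α) ≤
      α * ∫ ζ : Circle, ‖(ζ : ℂ) - ξ‖ * ‖base ζ z‖ ^ (-α - 1) ∂ν.variation := by
  have h1 := VectorMeasure.norm_integral_le_integral_norm (μ := ν)
    (f := fun ζ => ratioDeriv α ξ ζ z) (B := ContinuousLinearMap.mul ℝ ℂ)
  rw [(hasDerivAt_integral_ratio hα hα1 h hz).deriv]
  rw [ContinuousLinearMap.opNorm_mul, one_mul] at h1
  have h2 : ∫ ζ : Circle, ‖ratioDeriv α ξ ζ z‖ ∂ν.variation = ‖base ξ z‖ ^ (α - 1) *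
      (α * ∫ ζ : Circle, ‖(ζ : ℂ) - ξ‖ * ‖base ζ z‖ ^ (-α - 1) ∂ν.variation) := by
    rw [← MeasureTheory.integral_const_mul, ← MeasureTheory.integral_const_mul]
    congr with ζ
    rw [norm_ratioDeriv hα]
    ring
  rw [h2] at h1
  have hpos := norm_base_pos ξ hz
  have h3 := mul_le_mul_of_nonneg_right h1 (Real.rpow_nonneg hpos.le (1 - α))
  refine h3.trans_eq ?_
  rw [mul_right_comm, ← Real.rpow_add hpos]
  simp

/-! ### Integrals of powers of the base over circles -/

/-- The point of the plane with polar coordinates `(r, θ)`. -/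
noncomputable def polar (r θ : ℝ) : ℂ := (r : ℂ) * Complex.exp ((θ : ℂ) * Complex.I)

lemma norm_polar {r : ℝ} (hr : 0 ≤ r) (θ : ℝ) : ‖polar r θ‖ = r := by
  rw [polar, norm_mul, Complex.norm_exp_ofReal_mul_I, mul_one, Complex.norm_real,
    Real.norm_of_nonneg hr]

lemma norm_polar_lt_one {r : ℝ} (hr : 0 ≤ r) (hr1 : r < 1) (θ : ℝ) : ‖polar r θ‖ < 1 := by
  rwa [norm_polar hr]

lemma continuous_polar : Continuous fun p : ℝ × ℝ => polar p.1 p.2 := by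
  unfold polar
  fun_prop

lemma continuous_polar_right (r : ℝ) : Continuous (polar r) :=
  continuous_polar.comp (Continuous.prodMk_right r)

lemma polar_periodic (r : ℝ) : Function.Periodic (polar r) (2 * Real.pi) := by
  intro θ
  have : ((θ + 2 * Real.pi : ℝ) : ℂ) * Complex.I
      = (θ : ℂ) * Complex.I + 2 * Real.pi * Complex.I := by push_cast; ring
  rw [polar, this, Complex.exp_periodic, polar]

lemma base_exp_polar (φ r θ : ℝ) : base (Circle.exp φ) (polar r θ) = 1 - polar r (θ - φ) := by
  have : (starRingEnd ℂ) (Circle.exp φ : ℂ) = Complex.exp (-(φ * Complex.I)) := by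
    rw [Circle.coe_exp, ← Complex.exp_conj]; simp
  rw [base, this, polar, polar, mul_left_comm, ← Complex.exp_add]
  push_cast
  ring_nf

lemma norm_base_exp_polar_comm (φ r θ : ℝ) :
    ‖base (Circle.exp φ) (polar r θ)‖ = ‖base (Circle.exp θ) (polar r φ)‖ := by
  have : polar r (φ - θ) = (starRingEnd ℂ) (polar r (θ - φ)) := by
    simp only [polar, map_mul, Complex.conj_ofReal, ← Complex.exp_conj, Complex.conj_I]
    push_cast
    ring_nf
  rw [base_exp_polar, base_exp_polar, this, ← RCLike.norm_conj, map_sub, map_one]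

lemma integral_comp_norm_base (ξ : Circle) (r : ℝ) (g : ℝ → ℝ) :
    ∫ θ in (0 : ℝ)..(2 * Real.pi), g ‖base ξ (polar r θ)‖ =
      ∫ θ in (0 : ℝ)..(2 * Real.pi), g ‖1 - polar r θ‖ := by
  obtain ⟨φ, rfl⟩ : ∃ φ, Circle.exp φ = ξ := ⟨_, Circle.exp_arg ξ⟩
  simp only [base_exp_polar]
  rw [intervalIntegral.integral_comp_sub_right (fun θ => g ‖1 - polar r θ‖)]
  have hper : Function.Periodic (fun θ => g ‖1 - polar r θ‖) (2 * Real.pi) :=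
    (polar_periodic r).comp fun z => g ‖1 - z‖
  have := hper.intervalIntegral_add_eq (0 - φ) 0
  rw [zero_add] at this
  rw [← this]
  congr 1
  ring

lemma norm_one_sub_exp (θ : ℝ) :
    ‖1 - Complex.exp ((θ : ℂ) * Complex.I)‖ = 2 * |Real.sin (θ / 2)| := by
  rw [norm_sub_rev, mul_comm (θ : ℂ), Complex.norm_exp_I_mul_ofReal_sub_one, norm_mul]
  simp

lemma norm_one_sub_polar_le {r θ : ℝ} (hr : 0 ≤ r) (hr1 : r ≤ 1) (hθ : 0 ≤ θ) :
    ‖1 - polar r θ‖ ≤ (1 - r) + θ := by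
  have e : 1 - polar r θ = ((1 - r : ℝ) : ℂ) + r * (1 - Complex.exp ((θ : ℂ) * Complex.I)) := by
    rw [polar]; push_cast; ring
  have h : ‖1 - Complex.exp ((θ : ℂ) * Complex.I)‖ ≤ θ := by
    rw [norm_one_sub_exp]
    have := Real.abs_sin_le_abs (x := θ / 2)
    rw [abs_of_nonneg (by positivity : 0 ≤ θ / 2)] at this
    linarith
  rw [e]
  refine (norm_add_le _ _).trans ?_
  rw [norm_mul, Complex.norm_real, Complex.norm_real, Real.norm_of_nonneg hr,
    Real.norm_of_nonneg (by linarith)]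
  nlinarith [norm_nonneg (1 - Complex.exp ((θ : ℂ) * Complex.I))]

lemma one_sub_le_norm_one_sub_polar {r : ℝ} (hr : 0 ≤ r) (θ : ℝ) :
    1 - r ≤ ‖1 - polar r θ‖ := by
  have := norm_sub_norm_le (1 : ℂ) (polar r θ)
  rwa [norm_one, norm_polar hr] at this

/-- With `N = ‖1 - polar r θ‖`: `1 - r ≤ N` and `2t/π ≤ |1 - e^{iθ}| ≤ N + (1 - r) ≤ 2N`, so `t ≤
πN`. -/
lemma le_norm_one_sub_polar {r θ t : ℝ} (hr : 0 ≤ r) (hr1 : r ≤ 1)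
    (ht : t / Real.pi ≤ |Real.sin (θ / 2)|) :
    (1 - r) + t ≤ (1 + Real.pi) * ‖1 - polar r θ‖ := by
  have h1 := one_sub_le_norm_one_sub_polar hr θ
  have h2 : 2 * |Real.sin (θ / 2)| ≤ ‖1 - polar r θ‖ + (1 - r) := by
    have e : 1 - Complex.exp ((θ : ℂ) * Complex.I)
        = (1 - polar r θ) - ((1 - r : ℝ) : ℂ) * Complex.exp ((θ : ℂ) * Complex.I) := by
      rw [polar]; push_cast; ring
    rw [← norm_one_sub_exp, e]
    refine (norm_sub_le _ _).trans_eq ?_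
    rw [norm_mul, Complex.norm_exp_ofReal_mul_I, Complex.norm_real,
      Real.norm_of_nonneg (by linarith), mul_one]
  rw [div_le_iff₀ Real.pi_pos] at ht
  nlinarith [Real.pi_pos]

lemma div_pi_le_sin {θ : ℝ} (h0 : 0 ≤ θ) (h1 : θ ≤ Real.pi) :
    θ / Real.pi ≤ |Real.sin (θ / 2)| := by
  refine le_trans ?_ (le_abs_self _)
  refine le_trans (le_of_eq ?_) (Real.mul_le_sin (by linarith) (by linarith))
  field_simp

/-- The two summands serve the halves of the circle, where `θ` is nearer to `0` or to `2π`. -/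
lemma norm_one_sub_polar_rpow_le {r θ p : ℝ} (hr : 0 ≤ r) (hr1 : r < 1) (h0 : 0 ≤ θ)
    (h1 : θ ≤ 2 * Real.pi) (hp : 0 ≤ p) :
    ‖1 - polar r θ‖ ^ (-p) ≤ (1 + Real.pi) ^ p *
      ((θ + (1 - r)) ^ (-p) + (2 * Real.pi - θ + (1 - r)) ^ (-p)) := by
  have hs : 0 < 1 - r := by linarith
  have hN : 0 < ‖1 - polar r θ‖ := hs.trans_le (one_sub_le_norm_one_sub_polar hr θ)
  have hpi : 0 < 1 + Real.pi := by linarith [Real.pi_pos]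
  have key {t : ℝ} (h0 : 0 ≤ t) (ht : t / Real.pi ≤ |Real.sin (θ / 2)|) :
      ‖1 - polar r θ‖ ^ (-p) ≤ (1 + Real.pi) ^ p * (t + (1 - r)) ^ (-p) := by
    have h := Real.rpow_le_rpow_of_nonpos (by linarith : 0 < (1 - r) + t)
      (le_norm_one_sub_polar hr hr1.le ht) (by linarith : -p ≤ 0)
    rw [Real.mul_rpow hpi.le hN.le, Real.rpow_neg hpi.le, inv_mul_le_iff₀ (by positivity)] at h
    rwa [add_comm t]
  rcases le_total θ Real.pi with h | h
  · refine (key h0 (div_pi_le_sin h0 h)).trans ?_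
    have : 0 ≤ (2 * Real.pi - θ + (1 - r)) ^ (-p) := Real.rpow_nonneg (by linarith) _
    gcongr
    linarith
  · have h3 := div_pi_le_sin (θ := 2 * Real.pi - θ) (by linarith) (by linarith)
    have e : (2 * Real.pi - θ) / 2 = Real.pi - θ / 2 := by ring
    rw [e, Real.sin_pi_sub] at h3
    refine (key (by linarith) h3).trans ?_
    have : 0 ≤ (θ + (1 - r)) ^ (-p) := Real.rpow_nonneg (by linarith) _
    gcongr
    linarith

lemma continuousOn_add_rpow {s : ℝ} (hs : 0 < s) (p : ℝ) {b : ℝ} (hb : 0 ≤ b) :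
    ContinuousOn (fun θ : ℝ => (θ + s) ^ p) (Set.uIcc 0 b) := by
  refine ContinuousOn.rpow_const (by fun_prop) fun θ hθ => Or.inl ?_
  rw [Set.uIcc_of_le hb] at hθ
  linarith [hθ.1]

lemma integral_add_rpow_le {s α b : ℝ} (hs : 0 < s) (hα : 0 < α) (hb : 0 ≤ b) :
    ∫ θ in (0 : ℝ)..b, (θ + s) ^ (-(α + 1)) ≤ s ^ (-α) / α := by
  rw [intervalIntegral.integral_comp_add_right (fun θ => θ ^ (-(α + 1))), integral_rpow]
  · have e : -(α + 1) + 1 = -α := by ring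
    have h : 0 ≤ (b + s) ^ (-α) := Real.rpow_nonneg (by linarith) _
    rw [e, zero_add, div_neg, ← neg_div]
    gcongr
    linarith
  · right
    refine ⟨by linarith, fun h => ?_⟩
    rw [zero_add, Set.uIcc_of_le (by linarith)] at h
    linarith [h.1]

lemma continuous_norm_base_rpow (p : ℝ) {r : ℝ} (hr : 0 ≤ r) (hr1 : r < 1) :
    Continuous fun x : Circle × ℝ => ‖base x.1 (polar r x.2)‖ ^ p := by
  have h : Continuous fun x : Circle × ℝ => base x.1 (polar r x.2) :=
    continuous_base.comp (continuous_fst.prodMk ((continuous_polar_right r).comp continuous_snd))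
  exact h.norm.rpow_const fun x => Or.inl (norm_base_pos _ (norm_polar_lt_one hr hr1 _)).ne'

theorem integral_norm_base_rpow_le {r α : ℝ} (hr : 0 ≤ r) (hr1 : r < 1) (hα : 0 < α)
    (hα1 : α ≤ 1) (ξ : Circle) :
    ∫ θ in (0 : ℝ)..(2 * Real.pi), ‖base ξ (polar r θ)‖ ^ (-α - 1) ≤
      2 * (1 + Real.pi) ^ 2 * ((1 - r) ^ (-α) / α) := by
  have hs : 0 < 1 - r := by linarith
  have h2pi : 0 ≤ 2 * Real.pi := by positivity
  have e : -α - 1 = -(α + 1) := by ring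
  have hcont : Continuous fun θ : ℝ => ‖1 - polar r θ‖ ^ (-(α + 1)) := by
    refine (continuous_const.sub (continuous_polar_right r)).norm.rpow_const fun θ => Or.inl ?_
    exact (hs.trans_le (one_sub_le_norm_one_sub_polar hr θ)).ne'
  have hi1 : IntervalIntegrable (fun θ : ℝ => (θ + (1 - r)) ^ (-(α + 1))) volume 0
      (2 * Real.pi) := (continuousOn_add_rpow hs (-(α + 1)) h2pi).intervalIntegrable
  have hi2 : IntervalIntegrable (fun θ : ℝ => (2 * Real.pi - θ + (1 - r)) ^ (-(α + 1))) volume 0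
      (2 * Real.pi) := by
    simpa using (hi1.comp_sub_left (2 * Real.pi)).symm
  have hrefl : ∫ θ in (0 : ℝ)..(2 * Real.pi), (2 * Real.pi - θ + (1 - r)) ^ (-(α + 1)) =
      ∫ θ in (0 : ℝ)..(2 * Real.pi), (θ + (1 - r)) ^ (-(α + 1)) := by
    rw [intervalIntegral.integral_comp_sub_left (fun θ => (θ + (1 - r)) ^ (-(α + 1)))]
    simp
  rw [integral_comp_norm_base ξ r (fun x => x ^ (-α - 1)), e]
  calc ∫ θ in (0 : ℝ)..(2 * Real.pi), ‖1 - polar r θ‖ ^ (-(α + 1))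
      ≤ ∫ θ in (0 : ℝ)..(2 * Real.pi), (1 + Real.pi) ^ (α + 1) *
        ((θ + (1 - r)) ^ (-(α + 1)) + (2 * Real.pi - θ + (1 - r)) ^ (-(α + 1))) :=
        intervalIntegral.integral_mono_on h2pi (hcont.intervalIntegrable _ _)
          ((hi1.add hi2).const_mul _)
          fun θ hθ => norm_one_sub_polar_rpow_le hr hr1 hθ.1 hθ.2 (by linarith)
    _ = (1 + Real.pi) ^ (α + 1) *
        (2 * ∫ θ in (0 : ℝ)..(2 * Real.pi), (θ + (1 - r)) ^ (-(α + 1))) := by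
        rw [intervalIntegral.integral_const_mul, intervalIntegral.integral_add hi1 hi2, hrefl]
        ring
    _ ≤ (1 + Real.pi) ^ (2 : ℝ) * (2 * ((1 - r) ^ (-α) / α)) := by
        have h1 := integral_add_rpow_le hs hα h2pi
        -- Here `α ≤ 1` frees the constant from `α`; the remaining `1/α` cancels against the `α` in
        -- `ratioDeriv`.
        have h2 : (1 + Real.pi) ^ (α + 1) ≤ (1 + Real.pi) ^ (2 : ℝ) :=
          Real.rpow_le_rpow_of_exponent_le (by linarith [Real.pi_pos]) (by linarith)
        have h3 : 0 ≤ ∫ θ in (0 : ℝ)..(2 * Real.pi), (θ + (1 - r)) ^ (-(α + 1)) :=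
          intervalIntegral.integral_nonneg h2pi fun θ hθ =>
            Real.rpow_nonneg (by linarith [hθ.1]) _
        gcongr
    _ = _ := by rw [Real.rpow_two]; ring

theorem log_le_integral_inv_norm_base {r : ℝ} (hr : 0 ≤ r) (hr1 : r < 1) (ξ : Circle) :
    Real.log (1 / (1 - r)) ≤ ∫ θ in (0 : ℝ)..(2 * Real.pi), ‖base ξ (polar r θ)‖⁻¹ := by
  have hs : 0 < 1 - r := by linarith
  have h2pi : 0 ≤ 2 * Real.pi := by positivity
  have hpos (θ : ℝ) := hs.trans_le (one_sub_le_norm_one_sub_polar hr θ)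
  have hcont : Continuous fun θ : ℝ => ‖1 - polar r θ‖⁻¹ :=
    (continuous_const.sub (continuous_polar_right r)).norm.inv₀ fun θ => (hpos θ).ne'
  have hne : ∀ θ ∈ Set.uIcc 0 (2 * Real.pi), θ + (1 - r) ≠ 0 := by
    intro θ hθ
    rw [Set.uIcc_of_le h2pi] at hθ
    linarith [hθ.1]
  rw [integral_comp_norm_base ξ r (fun x => x⁻¹)]
  calc Real.log (1 / (1 - r)) ≤ Real.log ((2 * Real.pi + (1 - r)) / (1 - r)) := by
        apply Real.log_le_log (by positivity)
        gcongr
        linarith [Real.pi_gt_three]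
    _ = ∫ θ in (0 : ℝ)..(2 * Real.pi), (θ + (1 - r))⁻¹ := by
        rw [intervalIntegral.integral_comp_add_right (fun θ => θ⁻¹), integral_inv_of_pos] <;>
          first | (rw [zero_add]) | linarith
        linarith
    _ ≤ _ := by
        refine intervalIntegral.integral_mono_on h2pi
          (ContinuousOn.inv₀ (by fun_prop) hne).intervalIntegrable
          (hcont.intervalIntegrable _ _) fun θ hθ => ?_
        have := norm_one_sub_polar_le hr hr1.le hθ.1
        exact inv_anti₀ (hpos θ) (by linarith)

/-! ### Integral means of the derivative -/

lemma continuous_norm_deriv_polar {f : ℂ → ℂ} (hf : DifferentiableOn ℂ f (ball (0 : ℂ) 1)) {r : ℝ}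
    (hr : 0 ≤ r) (hr1 : r < 1) : Continuous fun θ => ‖deriv f (polar r θ)‖ :=
  ((hf.deriv isOpen_ball).continuousOn.comp_continuous (continuous_polar_right r) fun θ =>
    mem_ball_zero_iff.2 (norm_polar_lt_one hr hr1 θ)).norm

lemma continuous_norm_base_rpow_right (p : ℝ) (ξ : Circle) {r : ℝ} (hr : 0 ≤ r) (hr1 : r < 1) :
    Continuous fun θ : ℝ => ‖base ξ (polar r θ)‖ ^ p := by
  have h : Continuous fun θ : ℝ => base ξ (polar r θ) := by
    unfold base polar
    fun_prop
  exact h.norm.rpow_const fun θ => Or.inl (norm_base_pos _ (norm_polar_lt_one hr hr1 _)).ne'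

/-- Integration over a circle of the pointwise bound for the derivative, with a weight. -/
theorem integral_weighted_norm_deriv_le {α : ℝ} (hα : 0 ≤ α) (hα1 : α ≤ 1) {f : ℂ → ℂ}
    (hf : DifferentiableOn ℂ f (ball (0 : ℂ) 1))
    {ν : ComplexMeasure Circle} {ξ : Circle}
    (h : Represents α ν fun z => f z * (1 / base ξ z ^ (α : ℂ))) {r : ℝ} (hr : 0 ≤ r)
    (hr1 : r < 1) {W : ℝ → ℝ} (hW : Continuous W) (hW0 : ∀ θ, 0 ≤ W θ) {D : ℝ}
    (hD : ∀ ζ : Circle, ∫ θ in (0 : ℝ)..(2 * Real.pi),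
      ‖(ζ : ℂ) - ξ‖ * ‖base ζ (polar r θ)‖ ^ (-α - 1) * W θ ≤ D) :
    ∫ θ in (0 : ℝ)..(2 * Real.pi),
      ‖deriv f (polar r θ)‖ * ‖base ξ (polar r θ)‖ ^ (1 - α) * W θ ≤
        α * (D * (ν.variation Set.univ).toReal) := by
  have h2pi : 0 ≤ 2 * Real.pi := by positivity
  have hG : Continuous fun x : ℝ × Circle =>
      ‖(x.2 : ℂ) - ξ‖ * ‖base x.2 (polar r x.1)‖ ^ (-α - 1) * W x.1 :=
    ((by fun_prop : Continuous fun x : ℝ × Circle => ‖(x.2 : ℂ) - ξ‖).mul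
      ((continuous_norm_base_rpow (-α - 1) hr hr1).comp continuous_swap)).mul
        (hW.comp continuous_fst)
  have hint : Integrable (Function.uncurry fun (θ : ℝ) (ζ : Circle) =>
      ‖(ζ : ℂ) - ξ‖ * ‖base ζ (polar r θ)‖ ^ (-α - 1) * W θ)
      ((volume.restrict (Set.uIoc 0 (2 * Real.pi))).prod ν.variation) := by
    have h1 := (hG.continuousOn (s := Set.uIcc 0 (2 * Real.pi) ×ˢ Set.univ)).integrableOn_compact
      (μ := (volume : Measure ℝ).prod ν.variation) (isCompact_uIcc.prod isCompact_univ)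
    rw [IntegrableOn, ← Measure.prod_restrict, Measure.restrict_univ] at h1
    exact h1.mono_measure (Measure.prod_mono (Measure.restrict_mono Set.uIoc_subset_uIcc le_rfl)
      le_rfl)
  have hswap := intervalIntegral_integral_swap hint
  have hinner : IntervalIntegrable (fun θ => ∫ ζ : Circle,
      ‖(ζ : ℂ) - ξ‖ * ‖base ζ (polar r θ)‖ ^ (-α - 1) * W θ ∂ν.variation) volume 0
      (2 * Real.pi) := by
    rw [intervalIntegrable_iff]
    exact hint.integral_prod_left
  have hL : Continuous fun θ =>
      ‖deriv f (polar r θ)‖ * ‖base ξ (polar r θ)‖ ^ (1 - α) * W θ :=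
    ((continuous_norm_deriv_polar hf hr hr1).mul
      (continuous_norm_base_rpow_right (1 - α) ξ hr hr1)).mul hW
  calc ∫ θ in (0 : ℝ)..(2 * Real.pi),
        ‖deriv f (polar r θ)‖ * ‖base ξ (polar r θ)‖ ^ (1 - α) * W θ
      ≤ ∫ θ in (0 : ℝ)..(2 * Real.pi), α * ∫ ζ : Circle,
        ‖(ζ : ℂ) - ξ‖ * ‖base ζ (polar r θ)‖ ^ (-α - 1) * W θ ∂ν.variation := by
        refine intervalIntegral.integral_mono_on h2pi (hL.intervalIntegrable _ _)
          (hinner.const_mul _) fun θ _ => ?_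
        rw [integral_mul_const, ← mul_assoc]
        exact mul_le_mul_of_nonneg_right
          (norm_deriv_mul_le hα hα1 h (norm_polar_lt_one hr hr1 θ)) (hW0 θ)
    _ = α * ∫ ζ : Circle, (∫ θ in (0 : ℝ)..(2 * Real.pi),
        -- Fubini brings the angular integral inside, where `hD` bounds it uniformly in `ζ`.
        ‖(ζ : ℂ) - ξ‖ * ‖base ζ (polar r θ)‖ ^ (-α - 1) * W θ) ∂ν.variation := by
        rw [intervalIntegral.integral_const_mul, hswap]
    _ ≤ α * ∫ _ : Circle, D ∂ν.variation := by
        refine mul_le_mul_of_nonneg_left (integral_mono ?_ (integrable_const _) hD) hα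
        simp_rw [intervalIntegral.integral_of_le h2pi, ← Set.uIoc_of_le h2pi]
        exact hint.integral_prod_right
    _ = α * (D * (ν.variation Set.univ).toReal) := by
        rw [integral_const, smul_eq_mul, mul_comm D]; rfl

theorem integral_norm_deriv_le {α : ℝ} (hα : 0 < α) (hα1 : α ≤ 1) {f : ℂ → ℂ}
    (hf : DifferentiableOn ℂ f (ball (0 : ℂ) 1)) {M : ℝ}
    (hM : multiplierNorm α f < ENNReal.ofReal M) {r : ℝ} (hr : 0 ≤ r) (hr1 : r < 1) :
    ∫ θ in (0 : ℝ)..(2 * Real.pi), ‖deriv f (polar r θ)‖ ≤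
      8 * (1 + Real.pi) ^ 2 * M * (1 - r) ^ (-α) := by
  have h2pi : 0 ≤ 2 * Real.pi := by positivity
  obtain ⟨B, hB⟩ : ∃ B, B = 2 * (1 + Real.pi) ^ 2 * ((1 - r) ^ (-α) / α) := ⟨_, rfl⟩
  have hB0 : 0 ≤ B := by
    have := Real.rpow_nonneg (by linarith : 0 ≤ 1 - r) (-α)
    rw [hB]; positivity
  have hM0 : 0 ≤ M := (ENNReal.ofReal_pos.1 (pos_of_gt hM)).le
  have key (ξ : Circle) : ∫ θ in (0 : ℝ)..(2 * Real.pi),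
      ‖deriv f (polar r θ)‖ * ‖base ξ (polar r θ)‖ ^ (1 - α) ≤ α * (2 * B * M) := by
    obtain ⟨ν, hν, hνM⟩ := exists_represents_mul_kernel hM ξ
    have h := integral_weighted_norm_deriv_le hα.le hα1 hf hν hr hr1 (W := fun _ => 1)
      continuous_const (fun _ => zero_le_one) (D := 2 * B) fun ζ => by
        simp only [mul_one]
        rw [intervalIntegral.integral_const_mul]
        have h0 : 0 ≤ ∫ θ in (0 : ℝ)..(2 * Real.pi), ‖base ζ (polar r θ)‖ ^ (-α - 1) :=
          intervalIntegral.integral_nonneg h2pi fun θ _ => Real.rpow_nonneg (norm_nonneg _) _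
        exact mul_le_mul (norm_coe_sub_coe_le_two ζ ξ)
          (hB ▸ integral_norm_base_rpow_le hr hr1 hα hα1 ζ) h0 zero_le_two
    simp only [mul_one] at h
    refine h.trans ?_
    have := ENNReal.toReal_le_of_le_ofReal hM0 hνM.le
    gcongr
  have hc (ξ : Circle) : Continuous fun θ =>
      ‖deriv f (polar r θ)‖ * ‖base ξ (polar r θ)‖ ^ (1 - α) :=
    (continuous_norm_deriv_polar hf hr hr1).mul
      (continuous_norm_base_rpow_right (1 - α) ξ hr hr1)
  -- The weight degenerates only near `ξ`; at antipodal points the bases sum to `2`, so one has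
  -- modulus at least `1`.
  have hpt (z : ℂ) : 1 ≤ ‖base 1 z‖ ^ (1 - α) + ‖base (-1) z‖ ^ (1 - α) := by
    have h2 : 2 ≤ ‖base 1 z‖ + ‖base (-1) z‖ := by
      refine le_trans (le_of_eq ?_) (norm_add_le _ _)
      have : base 1 z + base (-1) z = 2 := by simp [base]; ring
      rw [this]; simp
    have hn (ξ : Circle) := Real.rpow_nonneg (norm_nonneg (base ξ z)) (1 - α)
    rcases le_total 1 ‖base 1 z‖ with h | h
    · linarith [Real.one_le_rpow h (by linarith : 0 ≤ 1 - α), hn (-1)]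
    · linarith [Real.one_le_rpow (by linarith : 1 ≤ ‖base (-1) z‖) (by linarith : 0 ≤ 1 - α),
        hn 1]
  calc ∫ θ in (0 : ℝ)..(2 * Real.pi), ‖deriv f (polar r θ)‖
      ≤ ∫ θ in (0 : ℝ)..(2 * Real.pi),
        (‖deriv f (polar r θ)‖ * ‖base 1 (polar r θ)‖ ^ (1 - α) +
          ‖deriv f (polar r θ)‖ * ‖base (-1) (polar r θ)‖ ^ (1 - α)) := by
        refine intervalIntegral.integral_mono_on h2pi
          ((continuous_norm_deriv_polar hf hr hr1).intervalIntegrable _ _)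
          (((hc 1).add (hc (-1))).intervalIntegrable _ _) fun θ _ => ?_
        rw [← mul_add]
        exact le_mul_of_one_le_right (norm_nonneg _) (hpt _)
    _ ≤ α * (2 * B * M) + α * (2 * B * M) := by
        rw [intervalIntegral.integral_add ((hc 1).intervalIntegrable _ _)
          ((hc (-1)).intervalIntegrable _ _)]
        exact add_le_add (key 1) (key (-1))
    _ = 8 * (1 + Real.pi) ^ 2 * M * (1 - r) ^ (-α) := by rw [hB]; field_simp; ring

lemma norm_coe_sub_coe_le (ζ ξ : Circle) (z : ℂ) :
    ‖(ζ : ℂ) - ξ‖ ≤ ‖base ζ z‖ + ‖base ξ z‖ := by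
  have e : (starRingEnd ℂ) ((ζ : ℂ) - ξ) = (starRingEnd ℂ) (ζ : ℂ) * base ξ z -
      (starRingEnd ℂ) (ξ : ℂ) * base ζ z := by
    simp only [base, map_sub]; ring
  rw [← RCLike.norm_conj, e]
  refine (norm_sub_le _ _).trans_eq ?_
  rw [norm_mul, norm_mul, norm_conj_coe, norm_conj_coe]
  ring

/-- The left side is `1/(ab) + 1/a²`; the inequality of means separates `a` from `b`. The exponent
`-1 - 1` is `-α - 1` at `α = 1`. -/
lemma add_mul_inv_le {a b : ℝ} (ha : 0 < a) (hb : 0 < b) :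
    (a + b) * a ^ (-1 - 1 : ℝ) * b⁻¹ ≤ 3 / 2 * a ^ (-1 - 1 : ℝ) + 1 / 2 * b ^ (-1 - 1 : ℝ) := by
  have e (x : ℝ) (hx : 0 < x) : x ^ (-1 - 1 : ℝ) = x⁻¹ ^ 2 := by
    rw [show (-1 - 1 : ℝ) = -(2 : ℝ) by norm_num, Real.rpow_neg hx.le, Real.rpow_two, inv_pow]
  rw [e a ha, e b hb]
  have h : (a + b) * a⁻¹ ^ 2 * b⁻¹ = a⁻¹ * b⁻¹ + a⁻¹ ^ 2 := by field_simp
  rw [h]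
  nlinarith [sq_nonneg (a⁻¹ - b⁻¹)]

theorem integral_norm_deriv_mul_log_le {f : ℂ → ℂ}
    (hf : DifferentiableOn ℂ f (ball (0 : ℂ) 1)) {M : ℝ}
    (hM : multiplierNorm 1 f < ENNReal.ofReal M) {r : ℝ} (hr : 0 ≤ r) (hr1 : r < 1) :
    (∫ θ in (0 : ℝ)..(2 * Real.pi), ‖deriv f (polar r θ)‖) * Real.log (1 / (1 - r)) ≤
      8 * Real.pi * (1 + Real.pi) ^ 2 * M * (1 / (1 - r)) := by
  have h2pi : 0 ≤ 2 * Real.pi := by positivity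
  obtain ⟨B, hB⟩ : ∃ B, B = 2 * (1 + Real.pi) ^ 2 * ((1 - r) ^ (-1 : ℝ) / 1) := ⟨_, rfl⟩
  have hB0 : 0 ≤ B := by
    have := Real.rpow_nonneg (by linarith : 0 ≤ 1 - r) (-1)
    rw [hB]; positivity
  have hM0 : 0 ≤ M := (ENNReal.ofReal_pos.1 (pos_of_gt hM)).le
  have hpos (ξ : Circle) (θ : ℝ) : 0 < ‖base ξ (polar r θ)‖ :=
    norm_base_pos ξ (norm_polar_lt_one hr hr1 θ)
  have hinv : Continuous fun x : ℝ × ℝ => ‖base (Circle.exp x.1) (polar r x.2)‖⁻¹ := by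
    have h : Continuous fun x : ℝ × ℝ => base (Circle.exp x.1) (polar r x.2) := by
      unfold base polar
      fun_prop
    exact h.norm.inv₀ fun x => (hpos _ _).ne'
  have hcb (ξ : Circle) : Continuous fun θ => ‖base ξ (polar r θ)‖ ^ (-1 - 1 : ℝ) :=
    continuous_norm_base_rpow_right (-1 - 1) ξ hr hr1
  have hci (ξ : Circle) : Continuous fun θ => ‖base ξ (polar r θ)‖⁻¹ :=
    by simpa only [Real.rpow_neg_one] using continuous_norm_base_rpow_right (-1) ξ hr hr1
  -- The weight `‖base ξ‖⁻¹` costs nothing in order: after `add_mul_inv_le` both terms are circle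
  -- integrals bounded by `B`, uniformly in `ξ`.
  have key (ξ : Circle) : ∫ θ in (0 : ℝ)..(2 * Real.pi),
      ‖deriv f (polar r θ)‖ * ‖base ξ (polar r θ)‖⁻¹ ≤ 2 * B * M := by
    obtain ⟨ν, hν, hνM⟩ := exists_represents_mul_kernel hM ξ
    have h := integral_weighted_norm_deriv_le zero_le_one le_rfl hf hν hr hr1
      (W := fun θ => ‖base ξ (polar r θ)‖⁻¹) (hci ξ) (fun θ => (inv_pos.2 (hpos ξ θ)).le)
      (D := 2 * B) fun ζ => by
        calc ∫ θ in (0 : ℝ)..(2 * Real.pi), ‖(ζ : ℂ) - ξ‖ * ‖base ζ (polar r θ)‖ ^ (-1 - 1 : ℝ) *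
              ‖base ξ (polar r θ)‖⁻¹
            ≤ ∫ θ in (0 : ℝ)..(2 * Real.pi), (3 / 2 * ‖base ζ (polar r θ)‖ ^ (-1 - 1 : ℝ) +
              1 / 2 * ‖base ξ (polar r θ)‖ ^ (-1 - 1 : ℝ)) := by
              refine intervalIntegral.integral_mono_on h2pi
                (((continuous_const.mul (hcb ζ)).mul (hci ξ)).intervalIntegrable _ _)
                (((continuous_const.mul (hcb ζ)).add
                  (continuous_const.mul (hcb ξ))).intervalIntegrable _ _) fun θ _ => ?_
              refine le_trans ?_ (add_mul_inv_le (hpos ζ θ) (hpos ξ θ))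
              have := norm_coe_sub_coe_le ζ ξ (polar r θ)
              gcongr
          _ ≤ 3 / 2 * B + 1 / 2 * B := by
              rw [intervalIntegral.integral_add
                (((hcb ζ).intervalIntegrable _ _).const_mul _)
                (((hcb ξ).intervalIntegrable _ _).const_mul _),
                intervalIntegral.integral_const_mul, intervalIntegral.integral_const_mul]
              have h1 := integral_norm_base_rpow_le hr hr1 one_pos le_rfl ζ
              have h2 := integral_norm_base_rpow_le hr hr1 one_pos le_rfl ξ
              rw [← hB] at h1 h2
              gcongr
          _ = 2 * B := by ring
    simp only [sub_self, Real.rpow_zero, mul_one, one_mul] at h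
    refine h.trans ?_
    have := ENNReal.toReal_le_of_le_ofReal hM0 hνM.le
    gcongr
  have hcd := continuous_norm_deriv_polar hf hr hr1
  have hG : Continuous fun x : ℝ × ℝ =>
      ‖deriv f (polar r x.2)‖ * ‖base (Circle.exp x.1) (polar r x.2)‖⁻¹ :=
    (hcd.comp continuous_snd).mul hinv
  have hG' : Continuous (Function.uncurry fun θ φ : ℝ =>
      ‖deriv f (polar r θ)‖ * ‖base (Circle.exp φ) (polar r θ)‖⁻¹) := by
    have h : Continuous fun x : ℝ × ℝ => base (Circle.exp x.2) (polar r x.1) := by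
      unfold base polar
      fun_prop
    exact (hcd.comp continuous_fst).mul (h.norm.inv₀ fun x => (hpos _ _).ne')
  have hswap : ∫ φ in (0 : ℝ)..(2 * Real.pi), ∫ θ in (0 : ℝ)..(2 * Real.pi),
        ‖deriv f (polar r θ)‖ * ‖base (Circle.exp φ) (polar r θ)‖⁻¹ =
      ∫ θ in (0 : ℝ)..(2 * Real.pi), ∫ φ in (0 : ℝ)..(2 * Real.pi),
        ‖deriv f (polar r θ)‖ * ‖base (Circle.exp φ) (polar r θ)‖⁻¹ :=
    intervalIntegral_intervalIntegral_swap
      ((hG.continuousOn.integrableOn_compact (isCompact_uIcc.prod isCompact_uIcc)).mono_set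
        (Set.prod_mono Set.uIoc_subset_uIcc Set.uIoc_subset_uIcc))
  calc (∫ θ in (0 : ℝ)..(2 * Real.pi), ‖deriv f (polar r θ)‖) * Real.log (1 / (1 - r))
      = ∫ θ in (0 : ℝ)..(2 * Real.pi), ‖deriv f (polar r θ)‖ * Real.log (1 / (1 - r)) := by
        rw [intervalIntegral.integral_mul_const]
    _ ≤ ∫ θ in (0 : ℝ)..(2 * Real.pi), ∫ φ in (0 : ℝ)..(2 * Real.pi),
        ‖deriv f (polar r θ)‖ * ‖base (Circle.exp φ) (polar r θ)‖⁻¹ := by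
        refine intervalIntegral.integral_mono_on h2pi
          ((hcd.mul continuous_const).intervalIntegrable _ _)
          (Continuous.intervalIntegrable
            (intervalIntegral.continuous_parametric_intervalIntegral_of_continuous'
              hG' _ _) _ _) fun θ _ => ?_
        rw [intervalIntegral.integral_const_mul]
        -- Swapping the angles turns the integral over `ξ` into one over a circle of radius `r`,
        -- which is at least the logarithm.
        simp only [norm_base_exp_polar_comm _ r θ]
        exact mul_le_mul_of_nonneg_left (log_le_integral_inv_norm_base hr hr1 _) (norm_nonneg _)
    _ ≤ ∫ _ in (0 : ℝ)..(2 * Real.pi), 2 * B * M := by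
        rw [← hswap]
        exact intervalIntegral.integral_mono_on h2pi
          (Continuous.intervalIntegrable
            (intervalIntegral.continuous_parametric_intervalIntegral_of_continuous' hG _ _) _ _)
          intervalIntegrable_const fun φ _ => key _
    _ = 8 * Real.pi * (1 + Real.pi) ^ 2 * M * (1 / (1 - r)) := by
        rw [intervalIntegral.integral_const, hB, Real.rpow_neg_one, smul_eq_mul]
        ring

/-! ### Green's formula for the area -/

lemma hasDerivAt_polar_left (ρ θ : ℝ) :
    HasDerivAt (fun ρ => polar ρ θ) (Complex.exp (θ * Complex.I)) ρ := by
  simpa [polar] using (Complex.ofRealCLM.hasDerivAt (x := ρ)).mul_const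
    (Complex.exp (θ * Complex.I))

lemma hasDerivAt_exp_mul_I (θ : ℝ) :
    HasDerivAt (fun θ : ℝ => Complex.exp (θ * Complex.I))
      (Complex.I * Complex.exp (θ * Complex.I)) θ := by
  simpa [mul_comm] using ((Complex.ofRealCLM.hasDerivAt (x := θ)).mul_const Complex.I).cexp

lemma hasDerivAt_polar_right (ρ θ : ℝ) :
    HasDerivAt (polar ρ) (Complex.I * polar ρ θ) θ := by
  refine ((hasDerivAt_exp_mul_I θ).const_mul (ρ : ℂ)).congr_deriv ?_
  rw [polar]; ring

/-- Twice the area function is a boundary integral. -/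
theorem two_mul_area {f : ℂ → ℂ} (hf : DifferentiableOn ℂ f (ball (0 : ℂ) 1)) {r : ℝ}
    (hr : 0 ≤ r) (hr1 : r < 1) :
    2 * (area r f : ℂ) = ∫ θ in (0 : ℝ)..(2 * Real.pi),
      star (f (polar r θ)) * (polar r θ * deriv f (polar r θ)) := by
  set g := deriv f
  set g' := deriv g
  have hgd : DifferentiableOn ℂ g (ball (0 : ℂ) 1) := hf.deriv isOpen_ball
  have hg'd : DifferentiableOn ℂ g' (ball (0 : ℂ) 1) := hgd.deriv isOpen_ball
  have hmem {ρ : ℝ} (hρ : ρ ∈ Set.uIcc 0 r) (θ : ℝ) : polar ρ θ ∈ ball (0 : ℂ) 1 := by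
    rw [Set.uIcc_of_le hr] at hρ
    exact mem_ball_zero_iff.2 (norm_polar_lt_one hρ.1 (hρ.2.trans_lt hr1) θ)
  have hF {z : ℂ} (hz : z ∈ ball (0 : ℂ) 1) : HasDerivAt f (g z) z :=
    (hf.differentiableAt (isOpen_ball.mem_nhds hz)).hasDerivAt
  have hGd {z : ℂ} (hz : z ∈ ball (0 : ℂ) 1) : HasDerivAt g (g' z) z :=
    (hgd.differentiableAt (isOpen_ball.mem_nhds hz)).hasDerivAt
  let e : ℝ → ℂ := fun θ => Complex.exp (θ * Complex.I)
  have he : Continuous e := by fun_prop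
  -- `H` is the `ρ`-derivative of `f̄ · z f'` and `K` the `θ`-derivative of `f̄ · e^{iθ} f'`, at `z
  -- = ρ e^{iθ}`. They differ as in `hHK`, and `K` integrates to zero by periodicity.
  let H : ℝ → ℝ → ℂ := fun ρ θ => star (e θ * g (polar ρ θ)) * (polar ρ θ * g (polar ρ θ)) +
    star (f (polar ρ θ)) * (e θ * g (polar ρ θ) + polar ρ θ * (e θ * g' (polar ρ θ)))
  let K : ℝ → ℝ → ℂ := fun ρ θ => star (Complex.I * polar ρ θ * g (polar ρ θ)) *
      (e θ * g (polar ρ θ)) + star (f (polar ρ θ)) *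
        (Complex.I * e θ * g (polar ρ θ) + e θ * (Complex.I * polar ρ θ * g' (polar ρ θ)))
  have hHK (ρ θ : ℝ) : H ρ θ = 2 * ((‖g (polar ρ θ)‖ ^ 2 * ρ : ℝ) : ℂ) - Complex.I * K ρ θ := by
    have e1 : star (e θ) * e θ = 1 := by
      rw [← starRingEnd_apply, Complex.conj_mul', Complex.norm_exp_ofReal_mul_I]; simp
    have e2 : star (g (polar ρ θ)) * g (polar ρ θ) = (‖g (polar ρ θ)‖ : ℂ) ^ 2 := by
      rw [← starRingEnd_apply, Complex.conj_mul']
    have e3 : polar ρ θ = ρ * e θ := rfl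
    have e4 : star (ρ : ℂ) = ρ := Complex.conj_ofReal ρ
    have e5 : star Complex.I = -Complex.I := Complex.conj_I
    simp only [H, K, star_mul']
    rw [show star (polar ρ θ) = ρ * star (e θ) by rw [e3, star_mul', e4], e5]
    push_cast
    rw [← e2]
    generalize star (g (polar ρ θ)) = a
    generalize g (polar ρ θ) = b
    generalize g' (polar ρ θ) = c
    generalize star (f (polar ρ θ)) = d
    rw [e3]
    linear_combination (2 * ρ * a * b) * e1 +
      (-a * b * ρ * star (e θ) * e θ + d * (e θ * b + e θ * ρ * e θ * c)) * Complex.I_sq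
  have hcH : ContinuousOn (Function.uncurry H) (Set.uIcc 0 r ×ˢ Set.univ) := by
    have hp : ContinuousOn (fun p : ℝ × ℝ => polar p.1 p.2) (Set.uIcc 0 r ×ˢ Set.univ) :=
      continuous_polar.continuousOn
    have hm : Set.MapsTo (fun p : ℝ × ℝ => polar p.1 p.2) (Set.uIcc 0 r ×ˢ Set.univ)
      (ball (0 : ℂ) 1) := fun p hp => hmem hp.1 p.2
    have h1 := hf.continuousOn.comp hp hm
    have h2 := hgd.continuousOn.comp hp hm
    have h3 := hg'd.continuousOn.comp hp hm
    have h4 : ContinuousOn (fun p : ℝ × ℝ => e p.2) (Set.uIcc 0 r ×ˢ Set.univ) :=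
      (he.comp continuous_snd).continuousOn
    exact ((h4.mul h2).star.mul (hp.mul h2)).add
      (h1.star.mul ((h4.mul h2).add (hp.mul (h4.mul h3))))
  have hcont {ρ : ℝ} (hρ : ρ ∈ Set.uIcc 0 r) : Continuous fun θ => f (polar ρ θ) :=
    hf.continuousOn.comp_continuous (continuous_polar_right ρ) (hmem hρ)
  have hcontg {ρ : ℝ} (hρ : ρ ∈ Set.uIcc 0 r) : Continuous fun θ => g (polar ρ θ) :=
    hgd.continuousOn.comp_continuous (continuous_polar_right ρ) (hmem hρ)
  have hcontg' {ρ : ℝ} (hρ : ρ ∈ Set.uIcc 0 r) : Continuous fun θ => g' (polar ρ θ) :=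
    hg'd.continuousOn.comp_continuous (continuous_polar_right ρ) (hmem hρ)
  have hcK {ρ : ℝ} (hρ : ρ ∈ Set.uIcc 0 r) : Continuous (K ρ) := by
    have h1 := hcont hρ
    have h2 := hcontg hρ
    have h3 := hcontg' hρ
    have h0 := continuous_polar_right ρ
    exact ((((continuous_const.mul h0).mul h2).star.mul (he.mul h2))).add
      (h1.star.mul (((continuous_const.mul he).mul h2).add
        (he.mul ((continuous_const.mul h0).mul h3))))
  have hintK {ρ : ℝ} (hρ : ρ ∈ Set.uIcc 0 r) : ∫ θ in (0 : ℝ)..(2 * Real.pi), K ρ θ = 0 := by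
    have hd : ∀ θ ∈ Set.uIcc 0 (2 * Real.pi), HasDerivAt
        (fun θ => star (f (polar ρ θ)) * (e θ * g (polar ρ θ))) (K ρ θ) θ := fun θ _ =>
      ((hF (hmem hρ θ)).scomp θ (hasDerivAt_polar_right ρ θ)).star.mul
        ((hasDerivAt_exp_mul_I θ).mul
          ((hGd (hmem hρ θ)).scomp θ (hasDerivAt_polar_right ρ θ)))
    rw [intervalIntegral.integral_eq_sub_of_hasDerivAt hd ((hcK hρ).intervalIntegrable _ _)]
    have hp : polar ρ (2 * Real.pi) = polar ρ 0 := by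
      simpa using polar_periodic ρ 0
    have he' : e (2 * Real.pi) = e 0 := by simp [e, Complex.exp_two_pi_mul_I]
    rw [hp, he', sub_self]
  have hintH (θ : ℝ) : ∫ ρ in (0 : ℝ)..r, H ρ θ =
      star (f (polar r θ)) * (polar r θ * g (polar r θ)) := by
    have hd : ∀ ρ ∈ Set.uIcc 0 r, HasDerivAt
        (fun ρ => star (f (polar ρ θ)) * (polar ρ θ * g (polar ρ θ))) (H ρ θ) ρ := fun ρ hρ => by
      have h1 : HasDerivAt (fun ρ => g (polar ρ θ)) (e θ * g' (polar ρ θ)) ρ :=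
        HasDerivAt.scomp (g₁ := g) (h := fun ρ => polar ρ θ) ρ (hGd (hmem hρ θ))
          (hasDerivAt_polar_left ρ θ)
      have h2 : HasDerivAt (fun ρ => f (polar ρ θ)) (e θ * g (polar ρ θ)) ρ :=
        HasDerivAt.scomp (g₁ := f) (h := fun ρ => polar ρ θ) ρ (hF (hmem hρ θ))
          (hasDerivAt_polar_left ρ θ)
      exact h2.star.mul ((hasDerivAt_polar_left ρ θ).mul h1)
    have hc : ContinuousOn (fun ρ => H ρ θ) (Set.uIcc 0 r) :=
      hcH.comp (f := fun ρ : ℝ => (ρ, θ)) (by fun_prop) fun ρ hρ => ⟨hρ, Set.mem_univ θ⟩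
    rw [intervalIntegral.integral_eq_sub_of_hasDerivAt hd hc.intervalIntegrable]
    -- The boundary term at `ρ = 0` vanishes through its factor `polar 0 θ`.
    simp [polar]
  have hswap : ∫ ρ in (0 : ℝ)..r, ∫ θ in (0 : ℝ)..(2 * Real.pi), H ρ θ =
      ∫ θ in (0 : ℝ)..(2 * Real.pi), ∫ ρ in (0 : ℝ)..r, H ρ θ :=
    intervalIntegral_intervalIntegral_swap
      (((hcH.mono (Set.prod_mono le_rfl (Set.subset_univ _))).integrableOn_compact
        (isCompact_uIcc.prod isCompact_uIcc)).mono_set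
        (Set.prod_mono Set.uIoc_subset_uIcc Set.uIoc_subset_uIcc))
  simp only [hintH] at hswap
  rw [← hswap, area, ← intervalIntegral.integral_ofReal, ← intervalIntegral.integral_const_mul]
  refine intervalIntegral.integral_congr fun ρ hρ => ?_
  have hi : Continuous fun θ => 2 * ((‖g (polar ρ θ)‖ ^ 2 * ρ : ℝ) : ℂ) :=
    continuous_const.mul
      (Complex.continuous_ofReal.comp (((hcontg hρ).norm.pow 2).mul continuous_const))
  simp only [hHK]
  rw [intervalIntegral.integral_sub (hi.intervalIntegrable _ _)
    (((hcK hρ).intervalIntegrable _ _).const_mul _),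
    intervalIntegral.integral_const_mul, intervalIntegral.integral_const_mul, hintK hρ, mul_zero,
    sub_zero, intervalIntegral.integral_ofReal]
  rfl

theorem two_mul_area_le {f : ℂ → ℂ} (hf : DifferentiableOn ℂ f (ball (0 : ℂ) 1))
    (hfb : hInftyNorm f < ∞) {r : ℝ} (hr : 0 ≤ r) (hr1 : r < 1) :
    2 * area r f ≤ (hInftyNorm f).toReal *
      ∫ θ in (0 : ℝ)..(2 * Real.pi), ‖deriv f (polar r θ)‖ := by
  have h2pi : 0 ≤ 2 * Real.pi := by positivity
  have h1 : 2 * area r f ≤ ‖2 * (area r f : ℂ)‖ := by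
    have := Complex.re_le_norm (2 * (area r f : ℂ))
    simpa using this
  refine h1.trans ?_
  rw [two_mul_area hf hr hr1, ← intervalIntegral.integral_const_mul]
  refine intervalIntegral.norm_integral_le_of_norm_le h2pi
    (Filter.Eventually.of_forall fun θ _ => ?_)
    ((continuous_const.mul (continuous_norm_deriv_polar hf hr hr1)).intervalIntegrable _ _)
  have hz := norm_polar_lt_one hr hr1 θ
  rw [norm_mul, norm_star, norm_mul]
  exact mul_le_mul (norm_le_hInftyNorm hfb hz)
    (mul_le_of_le_one_left (norm_nonneg _) hz.le) (by positivity) ENNReal.toReal_nonneg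

/-! ### Passage to the multiplier norm and conclusion -/

lemma le_mul_toReal_of_forall_lt {a C : ℝ} {N : ℝ≥0∞} (hN : N < ∞)
    (h : ∀ M : ℝ, N < ENNReal.ofReal M → a ≤ C * M) : a ≤ C * N.toReal := by
  have ht : Filter.Tendsto (fun M : ℝ => C * M) (nhdsWithin N.toReal (Set.Ioi N.toReal))
      (nhds (C * N.toReal)) :=
    ((continuous_const.mul continuous_id).tendsto _).mono_left nhdsWithin_le_nhds
  refine ge_of_tendsto ht ?_
  filter_upwards [self_mem_nhdsWithin] with M hM
  exact h M ((ENNReal.lt_ofReal_iff_toReal_lt hN.ne).2 hM)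

theorem area_le {α : ℝ} (hα : 0 < α) (hα1 : α ≤ 1) {f : ℂ → ℂ} (hf : f ∈ multipliers α) {r : ℝ}
    (hr : 0 ≤ r) (hr1 : r < 1) :
    area r f ≤ 4 * Real.pi * (1 + Real.pi) ^ 2 * (hInftyNorm f).toReal *
      (multiplierNorm α f).toReal * (1 / (1 - r) ^ α) := by
  have hs : 0 < 1 - r := by linarith
  have hfb := hInftyNorm_lt_top hα.le hf
  have h := le_mul_toReal_of_forall_lt (a := area r f)
    (C := 4 * (1 + Real.pi) ^ 2 * (hInftyNorm f).toReal * (1 - r) ^ (-α))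
    (multiplierNorm_lt_top hα.le hf) fun M hM => by
      have h1 := two_mul_area_le hf.1 hfb hr hr1
      have h2 := mul_le_mul_of_nonneg_left (integral_norm_deriv_le hα hα1 hf.1 hM hr hr1)
        (ENNReal.toReal_nonneg (a := hInftyNorm f))
      linarith
  refine h.trans ?_
  rw [Real.rpow_neg hs.le, one_div]
  have h0 : 0 ≤ 4 * (1 + Real.pi) ^ 2 * (hInftyNorm f).toReal * ((1 - r) ^ α)⁻¹ *
      (multiplierNorm α f).toReal := by
    have := Real.rpow_nonneg hs.le α
    positivity
  -- A spare factor `π` gives the constant of the logarithmic case.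
  nlinarith [Real.pi_gt_three]

theorem area_le_log {f : ℂ → ℂ} (hf : f ∈ multipliers 1) {r : ℝ} (hr : 0 < r) (hr1 : r < 1) :
    area r f ≤ 4 * Real.pi * (1 + Real.pi) ^ 2 * (hInftyNorm f).toReal *
      (multiplierNorm 1 f).toReal * (1 / (1 - r)) * (1 / Real.log (1 / (1 - r))) := by
  have hs : 0 < 1 - r := by linarith
  -- Here `r > 0` is essential: the logarithm vanishes at `r = 0`.
  have hlog : 0 < Real.log (1 / (1 - r)) := by
    apply Real.log_pos
    rw [lt_div_iff₀ hs]
    linarith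
  have hfb := hInftyNorm_lt_top zero_le_one hf
  rw [mul_one_div, le_div_iff₀ hlog]
  have h := le_mul_toReal_of_forall_lt (a := area r f * Real.log (1 / (1 - r)))
    (C := 4 * Real.pi * (1 + Real.pi) ^ 2 * (hInftyNorm f).toReal * (1 / (1 - r)))
    (multiplierNorm_lt_top zero_le_one hf) fun M hM => by
      have h1 := mul_le_mul_of_nonneg_right (two_mul_area_le hf.1 hfb hr.le hr1) hlog.le
      have h2 := mul_le_mul_of_nonneg_left (integral_norm_deriv_mul_log_le hf.1 hM hr.le hr1)
        (ENNReal.toReal_nonneg (a := hInftyNorm f))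
      linarith
  linarith

end FractionalCauchy

theorem mainTheorem2 :
    ∃ c : ℝ, 0 < c ∧
      (∀ α : ℝ, 0 < α → α < 1 → ∀ f : ℂ → ℂ, f ∈ FractionalCauchy.multipliers α →
        FractionalCauchy.hInftyNorm f < ∞ ∧
        FractionalCauchy.multiplierNorm α f < ∞ ∧
        ∀ r : ℝ, 0 ≤ r → r < 1 →
          FractionalCauchy.area r f ≤
            c * (FractionalCauchy.hInftyNorm f).toReal *
              (FractionalCauchy.multiplierNorm α f).toReal * (1 / (1 - r) ^ α)) ∧
      (∀ f : ℂ → ℂ, f ∈ FractionalCauchy.multipliers 1 →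
        FractionalCauchy.hInftyNorm f < ∞ ∧
        FractionalCauchy.multiplierNorm 1 f < ∞ ∧
        ∀ r : ℝ, 0 < r → r < 1 →
          FractionalCauchy.area r f ≤
            c * (FractionalCauchy.hInftyNorm f).toReal *
              (FractionalCauchy.multiplierNorm 1 f).toReal *
                (1 / (1 - r)) * (1 / Real.log (1 / (1 - r)))) := by
  refine ⟨4 * Real.pi * (1 + Real.pi) ^ 2, by positivity, fun α hα hα1 f hf => ?_, fun f hf => ?_⟩
  · exact ⟨FractionalCauchy.hInftyNorm_lt_top hα.le hf,
      FractionalCauchy.multiplierNorm_lt_top hα.le hf,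
      fun r hr hr1 => FractionalCauchy.area_le hα hα1.le hf hr hr1⟩
  · exact ⟨FractionalCauchy.hInftyNorm_lt_top zero_le_one hf,
      FractionalCauchy.multiplierNorm_lt_top zero_le_one hf,
      fun r hr hr1 => FractionalCauchy.area_le_log hf hr hr1⟩
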